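/- **Setting.** Let $\mathbb R^d=\prod_{k=1}^M\mathbb R^{n_k}$ with $n_k\ge 1$, and write $x=(x_1,\dots,x_M)$ with $x_k=(x_{k1},\dots,x_{kn_k})\in\mathbb R^{n_k}$. Let $p_k>1$, $1/p_k+1/q_k=1$, and $\|x_k\|_r=(\sum_{i}|x_{ki}|^r)^{1/r}$. Let $X=(X_1,\dots,X_M)$ be a random vector in isotropic position ($\mathbf E X=0$, $\mathrm{Cov}\,X=\mathrm{Id}$) whose blocks $X_k$ are independent with densities $\exp(-U_k(\|x_k\|_{p_k}^{p_k}))$, where the $U_k$ are convex and increasing on $[0,\infty)$. Put $X_t=\langle t,X\rangle$. Let $\tilde R_k,V_k$ ($1\le k\le M$) be independent, where $V_k$ is distributed according to the cone measure on $\{x\in\mathbb R^{n_k}:\|x\|_{p_k}=1\}$ (the law of $\xi/\|\xi\|_{p_k}$ for $\xi$ uniform on the unit ball of $\|\cdot\|_{p_k}$) and $\tilde R_k$ has on $(0,\infty)$ the density $$\frac{b_k^{n_k/p_k}}{\frac1{p_k}\Gamma(n_k/p_k)}\,s^{n_k-1}e^{-b_ks^{p_k}},\qquad b_k=\Big[\frac{\Gamma(3/p_k)}{\Gamma(1/p_k)}\Big]^{p_k/2}.$$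 Put $Q_k=\tilde R_k/\|\tilde R_k\|_2$ and $W_k=\|\tilde R_k\|_2V_k$. Let $p\ge 1$, $C_1\ge1$, $\delta>0$ and $0<\rho\le e^{-1}$ with $\rho/\log(1/\rho)=4C_1\delta$, and let $T\subset\mathbb R^d$ be a cube-like set: $0\in T$ and $e^p\le|T|\le 1+e^p$; there are numbers $\kappa_{ki}\ge\rho$ with $t_{ki}\in\{0,\kappa_{ki}\}$ for all $t\in T$ and all $k,i$; $\sum_{(k,i):\,t_{ki}=\kappa_{ki}}\kappa_{ki}\le 2C_1\delta p$ for all $t\in T$; and $\|X_t-X_s\|_p\ge p$ for all distinct $s,t\in T$. Let $A,D\ge1$ satisfy $A^{p_k}\ge D^{q_k}$ for all $k$. The small part $t^*$ of $t$ is defined by $t^*_k=t_k$ if $D^{q_k}\|t_k\|_{q_k}^{q_k}\le A^{p_k}n_k$, and $t^*_k=0$ otherwise. **Theorem.** For all $A\ge1$ and $c>0$ there is $C_0>0$, depending only on $A$ and $c$, such that for every $C\ge C_0$, in every setting as above with this $A$, and for every $t\in T$, $$\Big\|\sum_{k=1}^M\Big((Q_k-C)_+\,|\langle W_k,t^*_k\rangle|\Big)\wedge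 D^{q_k}\|t_k\|_{q_k}^{q_k}\Big\|_p\le c\,p .$$ -/

import Mathlib

open MeasureTheory ProbabilityTheory

namespace RadialSudakov

noncomputable section

/-- `‖x‖_r ^ r = ∑ i, |x i| ^ r`. -/
def lrPow {n : ℕ} (r : ℝ) (x : Fin n → ℝ) : ℝ := ∑ i, |x i| ^ r

/-- The norm `‖x‖_r = (∑ i, |x i| ^ r) ^ (1 / r)`. -/
def lrNorm {n : ℕ} (r : ℝ) (x : Fin n → ℝ) : ℝ := lrPow r x ^ (1 / r)

/-- The pairing `⟨x, t⟩` on one block. -/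
def pairing {n : ℕ} (x t : Fin n → ℝ) : ℝ := ∑ i, x i * t i

/-- The measure `exp (-U (‖x‖_r ^ r)) dx` on `ℝⁿ`. -/
def radialMeasure (n : ℕ) (r : ℝ) (U : ℝ → ℝ) : Measure (Fin n → ℝ) :=
  (volume : Measure (Fin n → ℝ)).withDensity
    fun x => ENNReal.ofReal (Real.exp (-U (lrPow r x)))

/-- The (probabilistic) cone measure on the sphere `{x | ‖x‖_r = 1}` of `ℝⁿ`: the law of
`x / ‖x‖_r` when `x` is uniformly distributed on the unit ball `{x | ‖x‖_r ≤ 1}`. -/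
def coneMeasure (n : ℕ) (r : ℝ) : Measure (Fin n → ℝ) :=
  (ProbabilityTheory.cond (volume : Measure (Fin n → ℝ)) {x | lrNorm r x ≤ 1}).map
    fun x => (lrNorm r x)⁻¹ • x

/-- The constant `b = (Γ(3/r) / Γ(1/r)) ^ (r/2)`, for which the density proportional to
`exp (-b |x| ^ r)` on `ℝ` has variance one. -/
def bConst (r : ℝ) : ℝ := (Real.Gamma (3 / r) / Real.Gamma (1 / r)) ^ (r / 2)

/-- The law of the radius `R̃`: the measure on `(0, ∞)` with density
`b ^ (n/r) / ((1/r) Γ(n/r)) * s ^ (n-1) * exp (-b s ^ r)`. -/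
def radiusLaw (n : ℕ) (r : ℝ) : Measure ℝ :=
  ((volume : Measure ℝ).restrict (Set.Ioi 0)).withDensity fun s => ENNReal.ofReal
    (bConst r ^ ((n : ℝ) / r) / ((1 / r) * Real.Gamma ((n : ℝ) / r))
      * s ^ ((n : ℝ) - 1) * Real.exp (-(bConst r) * s ^ r))

variable {M : ℕ} {n : Fin M → ℕ} {Ω : Type*} [MeasurableSpace Ω]

/-- Points of `ℝᵈ`, `d = n₁ + ⋯ + n_M`, written in blocks `x = (x₁, …, x_M)`, `x_k ∈ ℝ^{n_k}`. -/
abbrev BlockVec (n : Fin M → ℕ) : Type := (k : Fin M) → Fin (n k) → ℝ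

/-- `X` is an isotropic random vector whose blocks `X_k` are independent with densities
`exp (-U_k (‖x_k‖_{p_k} ^ {p_k}))`, where every `U_k` is convex and increasing on `[0, ∞)`. -/
structure IsRadialVector (pk : Fin M → ℝ) (U : Fin M → ℝ → ℝ) (P : Measure Ω)
    (X : Ω → BlockVec n) : Prop where
  convex : ∀ k, ConvexOn ℝ (Set.Ici 0) (U k)
  increasing : ∀ k, MonotoneOn (U k) (Set.Ici 0)
  probability : ∀ k, IsProbabilityMeasure (radialMeasure (n k) (pk k) (U k))
  law : HasLaw X (Measure.pi fun k => radialMeasure (n k) (pk k) (U k)) P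
  mean_zero : ∀ a : Σ k, Fin (n k), ∫ ω, X ω a.1 a.2 ∂P = 0
  covariance : ∀ a b : Σ k, Fin (n k),
    ∫ ω, X ω a.1 a.2 * X ω b.1 b.2 ∂P = if a = b then 1 else 0

/-- The radii `R̃_k` and the directions `V_k`: `R̃_k` has the law `radiusLaw`, `V_k` has the cone
measure as its law, and all of `R̃_1, …, R̃_M, V_1, …, V_M` are independent. -/
structure IsPolarSystem (pk : Fin M → ℝ) (P : Measure Ω)
    (R : Fin M → Ω → ℝ) (V : (k : Fin M) → Ω → Fin (n k) → ℝ) : Prop where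
  law_radius : ∀ k, HasLaw (R k) (radiusLaw (n k) (pk k)) P
  law_direction : ∀ k, HasLaw (V k) (coneMeasure (n k) (pk k)) P
  indep_pair : ∀ k, IndepFun (R k) (V k) P
  indep_blocks : iIndepFun (fun k ω => (R k ω, V k ω)) P

/-- The `L²` norm of a real random variable. -/
def l2Norm (P : Measure Ω) (f : Ω → ℝ) : ℝ := Real.sqrt (∫ ω, f ω ^ 2 ∂P)

/-- `Q = R̃ / ‖R̃‖₂`. -/
def normalizedRadius (P : Measure Ω) (R : Ω → ℝ) (ω : Ω) : ℝ := R ω / l2Norm P R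

/-- `W = ‖R̃‖₂ V`. -/
def normalizedDirection {m : ℕ} (P : Measure Ω) (R : Ω → ℝ) (V : Ω → Fin m → ℝ) (ω : Ω) :
    Fin m → ℝ := l2Norm P R • V ω

/-- The cube-like sets: `T` has between `e ^ p` and `1 + e ^ p` points, contains `0`, has
`t_i ∈ {0, κ_i}` with `κ_i ≥ ρ` for each coordinate `i`, has thin supports in the sense
`∑_{i ∈ I(t)} κ_i ≤ 2 C₁ δ p` with `I(t) = {i | t_i = κ_i}`, and
`‖X_t - X_s‖_p ≥ p` for distinct `s, t ∈ T`. -/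
structure IsCubeLike (P : Measure Ω) (X : Ω → BlockVec n) (p C₁ δ ρ : ℝ)
    (κ : BlockVec n) (T : Finset (BlockVec n)) : Prop where
  card_lower : Real.exp p ≤ (T.card : ℝ)
  card_upper : (T.card : ℝ) ≤ 1 + Real.exp p
  zero_mem : 0 ∈ T
  le_side : ∀ k i, ρ ≤ κ k i
  coord : ∀ t ∈ T, ∀ k i, t k i = 0 ∨ t k i = κ k i
  thin : ∀ t ∈ T, ∑ k, ∑ i with t k i = κ k i, κ k i ≤ 2 * C₁ * δ * p
  separated : ∀ s ∈ T, ∀ t ∈ T, s ≠ t → ENNReal.ofReal p ≤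
    eLpNorm (fun ω => ∑ k, pairing (X ω k) (t k) - ∑ k, pairing (X ω k) (s k))
      (ENNReal.ofReal p) P

/-- The truncation level `D ^ q * ‖u‖_q ^ q` of a block `u`, with `1/r + 1/q = 1`. -/
def level (D r : ℝ) {m : ℕ} (u : Fin m → ℝ) : ℝ :=
  D ^ r.conjExponent * lrPow r.conjExponent u

open Classical in
/-- The small part `u⋆` of a block `u ∈ ℝᵐ`: it is `u` if `D ^ q ‖u‖_q ^ q ≤ A ^ r m`, and `0`
otherwise. -/
def smallPart (A D r : ℝ) {m : ℕ} (u : Fin m → ℝ) : Fin m → ℝ :=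
  if level D r u ≤ A ^ r * (m : ℝ) then u else 0

/-- The random variable
`∑_k ((Q_k - C)_+ |⟨W_k, t⋆_k⟩|) ∧ (D ^ {q_k} ‖t_k‖_{q_k} ^ {q_k})`. -/
def truncatedExcess (pk : Fin M → ℝ) (P : Measure Ω) (R : Fin M → Ω → ℝ)
    (V : (k : Fin M) → Ω → Fin (n k) → ℝ) (A D C : ℝ) (t : BlockVec n) (ω : Ω) : ℝ :=
  ∑ k, min (max (normalizedRadius P (R k) ω - C) 0
      * |pairing (normalizedDirection P (R k) (V k) ω) (smallPart A D (pk k) (t k))|)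
    (level D (pk k) (t k))

end

end RadialSudakov

/-!
The truncated excess has an exponential moment of order `1 / c` of size at most `exp p`, and this
alone gives the bound `c * p` for its `L ^ p` norm (`eLpNorm_le_of_exp_le`).

Two facts yield the exponential moment. A block that survives the passage to the small part has
truncation level at most `A ^ r * n`, and its summand vanishes unless the normalized radius `Q`
exceeds `C`. The event `Q > C` has probability at most `exp (-A ^ r * n / c)` once `C` is large
in terms of `A` and `c` only (`prob_radius_gt_le`): here `b * R ^ r` has a Gamma law of shape
`n / r`, Chernoff's bound controls its upper tail, and a small ball estimate together with
`Γ (a + 1) ≥ (a / e) ^ a` shows `‖R‖₂ ≥ (n / b) ^ (1 / r) / (4 e)` (`le_l2Norm_of_hasLaw`).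
Hence a nonzero block multiplies the exponential moment by at most `2`, whatever its dimension and
exponent (`integral_one_add_smallWeight_le`). Moreover a point of a cube-like set has at most `p`
nonzero blocks (`card_ne_zero_le`), and the radii are independent, so the exponential moment is at
most `2 ^ p`.
-/

namespace RadialSudakov

open Set

/-! ### Tails of the radius -/

lemma rpow_self_le_Gamma_add_one {a : ℝ} (ha : 0 < a) :
    (a / Real.exp 1) ^ a ≤ Real.Gamma (a + 1) := by
  have hint : IntegrableOn (fun x : ℝ => Real.exp (-x) * x ^ (a + 1 - 1)) (Ioi 0) :=
    Real.GammaIntegral_convergent (by linarith)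
  calc (a / Real.exp 1) ^ a = ∫ x in Ioi a, Real.exp (-x) * a ^ a := by
        rw [integral_mul_const, integral_exp_neg_Ioi, Real.div_rpow ha.le (Real.exp_pos _).le,
          Real.exp_one_rpow, Real.exp_neg]
        ring
    _ ≤ ∫ x in Ioi a, Real.exp (-x) * x ^ (a + 1 - 1) := by
        refine setIntegral_mono_on ((integrableOn_exp_neg_Ioi a).mul_const _)
          (hint.mono_set (Ioi_subset_Ioi ha.le)) measurableSet_Ioi fun x hx => ?_
        have hx : a < x := hx
        rw [add_sub_cancel_right]
        gcongr
    _ ≤ ∫ x in Ioi 0, Real.exp (-x) * x ^ (a + 1 - 1) := by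
        refine setIntegral_mono_set hint ?_ (Ioi_subset_Ioi ha.le).eventuallyLE
        refine (ae_restrict_iff' measurableSet_Ioi).2 (Filter.Eventually.of_forall fun x hx => ?_)
        have hx : 0 < x := hx
        positivity
    _ = Real.Gamma (a + 1) := (Real.Gamma_eq_integral (by linarith)).symm

lemma bConst_pos {r : ℝ} (hr : 0 < r) : 0 < bConst r :=
  Real.rpow_pos_of_pos (div_pos (Real.Gamma_pos_of_pos (by positivity))
    (Real.Gamma_pos_of_pos (by positivity))) _

lemma radiusLaw_apply (n : ℕ) (r : ℝ) {S : Set ℝ} (hS : MeasurableSet S) :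
    radiusLaw n r S = ∫⁻ s in S ∩ Ioi 0, ENNReal.ofReal
      (bConst r ^ ((n : ℝ) / r) / ((1 / r) * Real.Gamma ((n : ℝ) / r))
        * s ^ ((n : ℝ) - 1) * Real.exp (-(bConst r) * s ^ r)) := by
  rw [radiusLaw, withDensity_apply _ hS, Measure.restrict_restrict hS]

/-- Chernoff bound: `b * s ^ r` has a Gamma law of shape `n / r` under `radiusLaw n r`, so its
exponential moment of order `1 / 2` is `2 ^ (n / r) ≤ 2 ^ n`. -/
lemma radiusLaw_Ioi_le {n : ℕ} {r s : ℝ} (hn : 1 ≤ n) (hr : 1 < r) (hs : 0 ≤ s) :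
    radiusLaw n r (Ioi s) ≤ ENNReal.ofReal (2 ^ n * Real.exp (-(bConst r * s ^ r / 2))) := by
  have hr0 : 0 < r := by linarith
  have hb := bConst_pos hr0
  have hn' : (1 : ℝ) ≤ n := by exact_mod_cast hn
  have hG : 0 < Real.Gamma ((n : ℝ) / r) := Real.Gamma_pos_of_pos (by positivity)
  set b := bConst r with hbdef
  set K := b ^ ((n : ℝ) / r) / ((1 / r) * Real.Gamma ((n : ℝ) / r)) with hK
  have hK0 : 0 < K := by positivity
  have hint : IntegrableOn (fun x : ℝ => x ^ ((n : ℝ) - 1) * Real.exp (-(b / 2) * x ^ r)) (Ioi 0) :=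
    integrableOn_rpow_mul_exp_neg_mul_rpow (by linarith) hr0 (by positivity)
  calc radiusLaw n r (Ioi s)
      = ∫⁻ x in Ioi s, ENNReal.ofReal (K * x ^ ((n : ℝ) - 1) * Real.exp (-b * x ^ r)) := by
        rw [radiusLaw_apply n r measurableSet_Ioi, inter_eq_left.2 (Ioi_subset_Ioi hs)]
    _ ≤ ∫⁻ x in Ioi s, ENNReal.ofReal (K * Real.exp (-(b * s ^ r / 2)) *
          (x ^ ((n : ℝ) - 1) * Real.exp (-(b / 2) * x ^ r))) := by
        refine setLIntegral_mono' measurableSet_Ioi fun x hx => ENNReal.ofReal_le_ofReal ?_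
        have hx : s < x := hx
        have hxp : 0 < x := hs.trans_lt hx
        have h1 : s ^ r ≤ x ^ r := Real.rpow_le_rpow hs hx.le hr0.le
        have h2 : Real.exp (-b * x ^ r) ≤
            Real.exp (-(b * s ^ r / 2)) * Real.exp (-(b / 2) * x ^ r) := by
          rw [← Real.exp_add]
          exact Real.exp_le_exp.2 (by nlinarith)
        calc _ ≤ K * x ^ ((n : ℝ) - 1) *
              (Real.exp (-(b * s ^ r / 2)) * Real.exp (-(b / 2) * x ^ r)) := by gcongr
          _ = _ := by ring
    _ ≤ ∫⁻ x in Ioi 0, ENNReal.ofReal (K * Real.exp (-(b * s ^ r / 2)) *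
          (x ^ ((n : ℝ) - 1) * Real.exp (-(b / 2) * x ^ r))) :=
        lintegral_mono_set (Ioi_subset_Ioi hs)
    _ = ENNReal.ofReal (2 ^ ((n : ℝ) / r) * Real.exp (-(b * s ^ r / 2))) := by
        rw [← ofReal_integral_eq_lintegral_ofReal (hint.const_mul _), integral_const_mul,
          integral_rpow_mul_exp_neg_mul_rpow hr0 (by linarith) (by positivity)]
        · congr 1
          rw [sub_add_cancel, neg_div, Real.rpow_neg (by positivity), Real.div_rpow hb.le (by norm_num),
            hK]
          field_simp
        · refine (ae_restrict_iff' measurableSet_Ioi).2 (Filter.Eventually.of_forall fun x hx => ?_)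
          have hx : 0 < x := hx
          positivity
    _ ≤ _ := by
        refine ENNReal.ofReal_le_ofReal ?_
        gcongr
        rw [← Real.rpow_natCast]
        exact Real.rpow_le_rpow_of_exponent_le (by norm_num)
          (div_le_self (by positivity) hr.le)

/-- Small ball estimate, obtained by discarding the factor `exp (-b s ^ r)` of the density. -/
lemma radiusLaw_Iic_le {n : ℕ} {r s : ℝ} (hn : 1 ≤ n) (hr : 0 < r) (hs : 0 ≤ s) :
    radiusLaw n r (Iic s) ≤
      ENNReal.ofReal (bConst r ^ ((n : ℝ) / r) * s ^ n / Real.Gamma ((n : ℝ) / r + 1)) := by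
  have hb := bConst_pos hr
  have hn' : (1 : ℝ) ≤ n := by exact_mod_cast hn
  have hG : 0 < Real.Gamma ((n : ℝ) / r) := Real.Gamma_pos_of_pos (by positivity)
  set b := bConst r with hbdef
  set K := b ^ ((n : ℝ) / r) / ((1 / r) * Real.Gamma ((n : ℝ) / r)) with hK
  have hK0 : 0 < K := by positivity
  have hint : IntervalIntegrable (fun x : ℝ => x ^ ((n : ℝ) - 1)) volume 0 s :=
    intervalIntegral.intervalIntegrable_rpow' (by linarith)
  rw [intervalIntegrable_iff_integrableOn_Ioc_of_le hs] at hint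
  calc radiusLaw n r (Iic s)
      = ∫⁻ x in Ioc 0 s, ENNReal.ofReal (K * x ^ ((n : ℝ) - 1) * Real.exp (-b * x ^ r)) := by
        rw [radiusLaw_apply n r measurableSet_Iic, inter_comm, Ioi_inter_Iic]
    _ ≤ ∫⁻ x in Ioc 0 s, ENNReal.ofReal (K * x ^ ((n : ℝ) - 1)) := by
        refine setLIntegral_mono' measurableSet_Ioc fun x hx => ENNReal.ofReal_le_ofReal ?_
        have hx0 : 0 < x := hx.1
        refine mul_le_of_le_one_right (by positivity) (Real.exp_le_one_iff.2 ?_)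
        have : 0 < b * x ^ r := by positivity
        linarith
    _ = _ := by
        rw [← ofReal_integral_eq_lintegral_ofReal (hint.const_mul _), integral_const_mul,
          ← intervalIntegral.integral_of_le hs, integral_rpow (Or.inl (by linarith))]
        · congr 1
          rw [sub_add_cancel, Real.zero_rpow (by linarith), Real.Gamma_add_one (by positivity), hK,
            Real.rpow_natCast]
          field_simp
          ring
        · refine (ae_restrict_iff' measurableSet_Ioc).2 (Filter.Eventually.of_forall fun x hx => ?_)
          have hx : 0 < x := hx.1
          positivity

lemma integrable_sq_radiusLaw {n : ℕ} {r : ℝ} (hr : 0 < r) :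
    Integrable (fun x : ℝ => x ^ 2) (radiusLaw n r) := by
  have hb := bConst_pos hr
  have hG : 0 ≤ Real.Gamma ((n : ℝ) / r) := Real.Gamma_nonneg_of_nonneg (by positivity)
  rw [radiusLaw, integrable_withDensity_iff_integrable_smul' (by fun_prop)
    (Filter.Eventually.of_forall fun _ => ENNReal.ofReal_lt_top)]
  have hint := (integrableOn_rpow_mul_exp_neg_mul_rpow (s := (n : ℝ) + 1) (p := r) (b := bConst r)
    (by linarith [n.cast_nonneg (α := ℝ)]) hr hb).const_mul
    (bConst r ^ ((n : ℝ) / r) / ((1 / r) * Real.Gamma ((n : ℝ) / r)))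
  refine hint.congr ((ae_restrict_iff' measurableSet_Ioi).2
    (Filter.Eventually.of_forall fun x hx => ?_))
  have hx : 0 < x := hx
  have h2 : x ^ ((n : ℝ) + 1) = x ^ ((n : ℝ) - 1) * x ^ 2 := by
    rw [← Real.rpow_natCast x 2, ← Real.rpow_add hx]
    congr 1
    push_cast
    ring
  simp only [smul_eq_mul]
  rw [ENNReal.toReal_ofReal (by positivity), h2]
  ring

lemma radiusLaw_Iic_le_half {n : ℕ} {r : ℝ} (hn : 1 ≤ n) (hr : 1 < r) :
    radiusLaw n r (Iic ((n / bConst r) ^ (1 / r) / (2 * Real.exp 1))) ≤ ENNReal.ofReal (1 / 2) := by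
  have hr0 : 0 < r := by linarith
  have hb := bConst_pos hr0
  have hn' : (1 : ℝ) ≤ n := by exact_mod_cast hn
  have hn0 : (0 : ℝ) < n := by linarith
  refine (radiusLaw_Iic_le hn hr0 (by positivity)).trans (ENNReal.ofReal_le_ofReal ?_)
  have hGam := rpow_self_le_Gamma_add_one (a := (n : ℝ) / r) (by positivity)
  have hG0 : 0 < Real.Gamma ((n : ℝ) / r + 1) := Real.Gamma_pos_of_pos (by positivity)
  have hpow : ((n / bConst r) ^ (1 / r)) ^ n = (n / bConst r) ^ ((n : ℝ) / r) := by
    rw [← Real.rpow_natCast, ← Real.rpow_mul (by positivity)]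
    congr 1
    ring
  rw [div_le_iff₀ hG0, div_pow, hpow, Real.div_rpow hn0.le hb.le]
  -- `r ≤ exp (r - 1)` turns `(r e) ^ (n / r)` into at most `e ^ n`
  have hre : r * Real.exp 1 ≤ Real.exp r := by
    have := Real.add_one_le_exp (r - 1)
    calc r * Real.exp 1 ≤ Real.exp (r - 1) * Real.exp 1 := by gcongr; linarith
      _ = Real.exp r := by rw [← Real.exp_add]; congr 1; ring
  have h1 : (n : ℝ) ^ ((n : ℝ) / r) ≤
      Real.exp 1 ^ n * (n / r / Real.exp 1) ^ ((n : ℝ) / r) := by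
    calc (n : ℝ) ^ ((n : ℝ) / r)
        = (r * Real.exp 1 * (n / r / Real.exp 1)) ^ ((n : ℝ) / r) := by
          congr 1; field_simp
      _ = (r * Real.exp 1) ^ ((n : ℝ) / r) * (n / r / Real.exp 1) ^ ((n : ℝ) / r) :=
          Real.mul_rpow (by positivity) (by positivity)
      _ ≤ Real.exp r ^ ((n : ℝ) / r) * (n / r / Real.exp 1) ^ ((n : ℝ) / r) := by gcongr
      _ = _ := by
          rw [← Real.exp_mul, mul_div_cancel₀ _ hr0.ne', Real.exp_one_pow]
  have h2 : (2 : ℝ) ≤ 2 ^ n := by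
    simpa using pow_le_pow_right₀ (by norm_num : (1 : ℝ) ≤ 2) hn
  calc _ = (n : ℝ) ^ ((n : ℝ) / r) / (2 ^ n * Real.exp 1 ^ n) := by
        rw [mul_pow]
        field_simp
    _ ≤ Real.exp 1 ^ n * (n / r / Real.exp 1) ^ ((n : ℝ) / r) / (2 * Real.exp 1 ^ n) := by
        gcongr
    _ = 1 / 2 * (n / r / Real.exp 1) ^ ((n : ℝ) / r) := by field_simp
    _ ≤ _ := by gcongr

section Radius

variable {Ω : Type*} [MeasurableSpace Ω] {P : Measure Ω} [IsProbabilityMeasure P]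
  {n : ℕ} {r : ℝ} {R : Ω → ℝ}

/-- Markov's inequality: the median of the radius is at least `(n / b) ^ (1 / r) / (2 e)`, and this
bounds its second moment from below, with a constant that does not depend on `n` and `r`. -/
lemma le_l2Norm_of_hasLaw (hn : 1 ≤ n) (hr : 1 < r) (hR : HasLaw R (radiusLaw n r) P) :
    (n / bConst r) ^ (1 / r) / (4 * Real.exp 1) ≤ l2Norm P R := by
  have hr0 : 0 < r := by linarith
  have hb := bConst_pos hr0
  have hprob : IsProbabilityMeasure (radiusLaw n r) := by
    rw [← hR.map_eq]
    exact Measure.isProbabilityMeasure_map hR.aemeasurable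
  have hint := integrable_sq_radiusLaw (n := n) hr0
  have heq : ∫ ω, R ω ^ 2 ∂P = ∫ x, x ^ 2 ∂(radiusLaw n r) :=
    hR.integral_comp hint.aestronglyMeasurable
  set s := (n / bConst r) ^ (1 / r) / (2 * Real.exp 1) with hs
  have hs0 : 0 ≤ s := by positivity
  have hhalf : (radiusLaw n r).real (Iic s) ≤ 1 / 2 :=
    ENNReal.toReal_le_of_le_ofReal (by norm_num) (radiusLaw_Iic_le_half hn hr)
  have hcompl : 1 / 2 ≤ (radiusLaw n r).real {x | s ^ 2 ≤ x ^ 2} := by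
    have h1 := probReal_add_probReal_compl (μ := radiusLaw n r) (measurableSet_Iic (a := s))
    have h2 : (radiusLaw n r).real (Iic s)ᶜ ≤ (radiusLaw n r).real {x | s ^ 2 ≤ x ^ 2} := by
      refine measureReal_mono fun x hx => ?_
      simp only [compl_Iic, mem_Ioi] at hx
      exact pow_le_pow_left₀ hs0 hx.le 2
    linarith
  have hmark := mul_meas_ge_le_integral_of_nonneg
    (Filter.Eventually.of_forall fun x : ℝ => sq_nonneg x) hint (s ^ 2)
  have : (n / bConst r) ^ (1 / r) / (4 * Real.exp 1) = s / 2 := by rw [hs]; ring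
  rw [this, l2Norm, heq]
  refine Real.le_sqrt_of_sq_le ?_
  nlinarith [sq_nonneg s]

/-- The normalized radius `Q` exceeds `C` with probability at most `exp (-L * A ^ r * n)`; the
threshold on `C` depends on neither `n` nor `r`. -/
lemma prob_radius_gt_le {A L C : ℝ} (hA : 1 ≤ A) (hL : 0 ≤ L)
    (hC : 8 * Real.exp 1 * A * (1 + L) ≤ C) (hn : 1 ≤ n) (hr : 1 < r)
    (hR : HasLaw R (radiusLaw n r) P) :
    P.real (R ⁻¹' Ioi (C * l2Norm P R)) ≤ Real.exp (-(L * (A ^ r * n))) := by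
  have hr0 : 0 < r := by linarith
  have hb := bConst_pos hr0
  have hn' : (1 : ℝ) ≤ n := by exact_mod_cast hn
  have hn0 : (0 : ℝ) < n := by linarith
  have hA0 : 0 < A := by linarith
  have hl2 := le_l2Norm_of_hasLaw hn hr hR
  have hAr : 1 ≤ A ^ r := Real.one_le_rpow hA hr0.le
  have hlev : A * (2 * (1 + L)) * (n / bConst r) ^ (1 / r) ≤ C * l2Norm P R := by
    calc A * (2 * (1 + L)) * (n / bConst r) ^ (1 / r)
        = 8 * Real.exp 1 * A * (1 + L) * ((n / bConst r) ^ (1 / r) / (4 * Real.exp 1)) := by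
          field_simp; ring
      _ ≤ _ := by gcongr; exact le_trans (by positivity) hC
  have hlev0 : 0 ≤ C * l2Norm P R := le_trans (by positivity) hlev
  -- `(2 * (1 + L)) ^ r` is only used through its lower bound `2 * (1 + L)`, as `r > 1`
  have hbs : 2 * ((1 + L) * (A ^ r * n)) ≤ bConst r * (C * l2Norm P R) ^ r := by
    calc 2 * ((1 + L) * (A ^ r * n)) = bConst r * (A ^ r * (2 * (1 + L)) ^ (1 : ℝ) *
          (n / bConst r)) := by
          rw [Real.rpow_one]; field_simp
      _ ≤ bConst r * (A ^ r * (2 * (1 + L)) ^ r * (n / bConst r)) := by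
          gcongr
          linarith
      _ = bConst r * (A * (2 * (1 + L)) * (n / bConst r) ^ (1 / r)) ^ r := by
          rw [Real.mul_rpow (x := A * (2 * (1 + L))) (by positivity) (by positivity),
            Real.mul_rpow (y := 2 * (1 + L)) hA0.le (by positivity),
            ← Real.rpow_mul (by positivity), one_div_mul_cancel hr0.ne', Real.rpow_one]
      _ ≤ _ := by gcongr
  have hmeas : P (R ⁻¹' Ioi (C * l2Norm P R)) = radiusLaw n r (Ioi (C * l2Norm P R)) := by
    rw [← hR.map_eq, Measure.map_apply_of_aemeasurable hR.aemeasurable measurableSet_Ioi]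
  rw [measureReal_def, hmeas]
  refine (ENNReal.toReal_le_of_le_ofReal (by positivity) (radiusLaw_Ioi_le hn hr hlev0)).trans ?_
  calc (2 : ℝ) ^ n * Real.exp (-(bConst r * (C * l2Norm P R) ^ r / 2))
      ≤ Real.exp 1 ^ n * Real.exp (-((1 + L) * (A ^ r * n))) := by
        gcongr
        · linarith [Real.add_one_le_exp 1]
        · linarith
    _ ≤ _ := by
        rw [Real.exp_one_pow, ← Real.exp_add]
        refine Real.exp_le_exp.2 ?_
        nlinarith

end Radius

/-! ### Exponential moments of one block -/

lemma level_nonneg {D r : ℝ} (hD : 0 ≤ D) {m : ℕ} (u : Fin m → ℝ) : 0 ≤ level D r u :=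
  mul_nonneg (Real.rpow_nonneg hD _)
    (Finset.sum_nonneg fun _ _ => Real.rpow_nonneg (abs_nonneg _) _)

open Classical in
/-- A bound for `exp (L * level D r u)` when `u` is nonzero and equal to its small part; it is `0`
in the remaining cases, where `u` contributes nothing to the truncated excess. -/
noncomputable def smallWeight (A D r L : ℝ) {m : ℕ} (u : Fin m → ℝ) : ℝ :=
  if u ≠ 0 ∧ level D r u ≤ A ^ r * m then Real.exp (L * (A ^ r * m)) else 0

lemma smallWeight_nonneg (A D r L : ℝ) {m : ℕ} (u : Fin m → ℝ) : 0 ≤ smallWeight A D r L u := by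
  unfold smallWeight
  split_ifs <;> positivity

section Block

variable {Ω : Type*} [MeasurableSpace Ω] {P : Measure Ω} {m : ℕ} {r : ℝ} {R : Ω → ℝ}

/-- One summand of the truncated excess is at most its truncation level, and it vanishes unless the
radius exceeds `C * ‖R‖₂` and the block is nonzero and equal to its small part. -/
lemma exp_truncated_le {A C D L : ℝ} (hD : 1 ≤ D) (hL : 0 ≤ L)
    (hl2 : 0 < l2Norm P R) (V : Ω → Fin m → ℝ) (u : Fin m → ℝ) (ω : Ω) :
    Real.exp (L * min (max (normalizedRadius P R ω - C) 0
        * |pairing (normalizedDirection P R V ω) (smallPart A D r u)|) (level D r u)) ≤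
      1 + (Ioi (C * l2Norm P R)).indicator (fun _ => smallWeight A D r L u) (R ω) := by
  have hlev : 0 ≤ level D r u := level_nonneg (by linarith) u
  have hw := smallWeight_nonneg A D r L u
  -- a vanishing first entry of the minimum makes the left side equal to one
  have key : max (normalizedRadius P R ω - C) 0
        * |pairing (normalizedDirection P R V ω) (smallPart A D r u)| = 0 →
      Real.exp (L * min (max (normalizedRadius P R ω - C) 0
        * |pairing (normalizedDirection P R V ω) (smallPart A D r u)|) (level D r u)) ≤
      1 + (Ioi (C * l2Norm P R)).indicator (fun _ => smallWeight A D r L u) (R ω) := by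
    intro h
    rw [h, min_eq_left hlev, mul_zero, Real.exp_zero]
    linarith [indicator_nonneg (s := Ioi (C * l2Norm P R))
      (f := fun _ : ℝ => smallWeight A D r L u) (fun _ _ => hw) (R ω)]
  by_cases hQ : C * l2Norm P R < R ω
  · by_cases hs : u ≠ 0 ∧ level D r u ≤ A ^ r * m
    · rw [indicator_of_mem (show R ω ∈ Ioi (C * l2Norm P R) from hQ), smallWeight, if_pos hs]
      have : Real.exp (L * min (max (normalizedRadius P R ω - C) 0
          * |pairing (normalizedDirection P R V ω) (smallPart A D r u)|) (level D r u)) ≤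
          Real.exp (L * (A ^ r * m)) :=
        Real.exp_le_exp.2 (mul_le_mul_of_nonneg_left ((min_le_right _ _).trans hs.2) hL)
      linarith
    · refine key ?_
      have : smallPart A D r u = 0 := by
        unfold smallPart
        split_ifs with h
        · by_contra h0
          exact hs ⟨h0, h⟩
        · rfl
      simp [this, pairing]
  · refine key ?_
    have : normalizedRadius P R ω ≤ C := by
      rw [normalizedRadius, div_le_iff₀ hl2]
      exact not_lt.1 hQ
    rw [max_eq_right (by linarith), zero_mul]

variable [IsProbabilityMeasure P]

open Classical in
/-- The tail of the radius beats the weight `exp (L * A ^ r * m)`, so a nonzero block contributes a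
factor of at most `2`, and a zero block a factor of at most `1`. -/
lemma integral_one_add_smallWeight_le {A C D L : ℝ} (hA : 1 ≤ A) (hL : 0 ≤ L)
    (hC : 8 * Real.exp 1 * A * (1 + L) ≤ C) (hm : 1 ≤ m) (hr : 1 < r)
    (hR : HasLaw R (radiusLaw m r) P) (u : Fin m → ℝ) :
    ∫ ω, (1 + (Ioi (C * l2Norm P R)).indicator (fun _ => smallWeight A D r L u) (R ω)) ∂P ≤
      if u = 0 then 1 else 2 := by
  have hnull : NullMeasurableSet (R ⁻¹' Ioi (C * l2Norm P R)) P :=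
    hR.aemeasurable.nullMeasurableSet_preimage measurableSet_Ioi
  have heq : ∀ ω, (Ioi (C * l2Norm P R)).indicator (fun _ => smallWeight A D r L u) (R ω) =
      (R ⁻¹' Ioi (C * l2Norm P R)).indicator (fun _ => smallWeight A D r L u) ω := fun _ => rfl
  simp only [heq]
  rw [integral_add (integrable_const _) ((integrable_const _).indicator₀ hnull),
    integral_indicator₀ hnull, setIntegral_const, integral_const, probReal_univ, smul_eq_mul,
    smul_eq_mul, one_mul]
  by_cases hu : u = 0
  · simp [hu, smallWeight]
  · rw [if_neg hu]
    have hw : smallWeight A D r L u ≤ Real.exp (L * (A ^ r * m)) := by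
      unfold smallWeight
      split_ifs <;> first | exact le_rfl | positivity
    have hP := prob_radius_gt_le hA hL hC hm hr hR
    have : P.real (R ⁻¹' Ioi (C * l2Norm P R)) * smallWeight A D r L u ≤ 1 := by
      calc _ ≤ Real.exp (-(L * (A ^ r * m))) * Real.exp (L * (A ^ r * m)) := by
            gcongr
            exact smallWeight_nonneg A D r L u
        _ = 1 := by rw [← Real.exp_add, neg_add_cancel, Real.exp_zero]
    linarith

end Block

/-! ### Moments of the sum -/

section MomentBound

variable {Ω : Type*} [MeasurableSpace Ω] {P : Measure Ω}

/-- An exponential moment of order `1 / c` that is at most `exp p` bounds the `L ^ p` norm by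
`c * p`, because `x ^ p ≤ (c * p / e) ^ p * exp (x / c)` for `x ≥ 0`. -/
lemma eLpNorm_le_of_exp_le {f G : Ω → ℝ} {p c : ℝ} (hp : 0 < p) (hc : 0 < c)
    (hf : ∀ ω, 0 ≤ f ω) (hfG : ∀ ω, Real.exp (c⁻¹ * f ω) ≤ G ω) (hG : Integrable G P)
    (hGp : ∫ ω, G ω ∂P ≤ Real.exp p) :
    eLpNorm f (ENNReal.ofReal p) P ≤ ENNReal.ofReal (c * p) := by
  have hpt : ∀ ω, ‖f ω‖ₑ ^ p ≤ ENNReal.ofReal ((c * p * Real.exp (-1)) ^ p * G ω) := by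
    intro ω
    rw [Real.enorm_of_nonneg (hf ω), ENNReal.ofReal_rpow_of_nonneg (hf ω) hp.le]
    refine ENNReal.ofReal_le_ofReal ?_
    have h1 : f ω ≤ c * p * Real.exp (-1) * Real.exp (c⁻¹ * f ω / p) := by
      have h := Real.add_one_le_exp (c⁻¹ * f ω / p - 1)
      rw [sub_add_cancel, sub_eq_add_neg, Real.exp_add] at h
      calc f ω = c * p * (c⁻¹ * f ω / p) := by field_simp
        _ ≤ c * p * (Real.exp (c⁻¹ * f ω / p) * Real.exp (-1)) := by gcongr
        _ = _ := by ring
    calc f ω ^ p ≤ (c * p * Real.exp (-1) * Real.exp (c⁻¹ * f ω / p)) ^ p :=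
          Real.rpow_le_rpow (hf ω) h1 hp.le
      _ = (c * p * Real.exp (-1)) ^ p * Real.exp (c⁻¹ * f ω) := by
          rw [Real.mul_rpow (by positivity) (by positivity), ← Real.exp_mul,
            div_mul_cancel₀ _ hp.ne']
      _ ≤ _ := by gcongr; exact hfG ω
  have hG0 : ∀ ω, 0 ≤ G ω := fun ω => (Real.exp_pos _).le.trans (hfG ω)
  rw [eLpNorm_eq_lintegral_rpow_enorm_toReal (by simpa using hp) ENNReal.ofReal_ne_top,
    ENNReal.toReal_ofReal hp.le]
  calc (∫⁻ ω, ‖f ω‖ₑ ^ p ∂P) ^ (1 / p)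
      ≤ (∫⁻ ω, ENNReal.ofReal ((c * p * Real.exp (-1)) ^ p * G ω) ∂P) ^ (1 / p) := by
        gcongr with ω
        exact hpt ω
    _ = (ENNReal.ofReal ((c * p * Real.exp (-1)) ^ p * ∫ ω, G ω ∂P)) ^ (1 / p) := by
        rw [← ofReal_integral_eq_lintegral_ofReal (hG.const_mul _)
          (Filter.Eventually.of_forall fun ω => mul_nonneg (by positivity) (hG0 ω)),
          integral_const_mul]
    _ ≤ (ENNReal.ofReal ((c * p) ^ p)) ^ (1 / p) := by
        gcongr
        calc (c * p * Real.exp (-1)) ^ p * ∫ ω, G ω ∂P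
            ≤ (c * p * Real.exp (-1)) ^ p * Real.exp p := by gcongr
          _ = (c * p) ^ p := by
            rw [Real.mul_rpow (by positivity) (by positivity), ← Real.exp_mul, mul_assoc,
              ← Real.exp_add]
            simp
    _ = ENNReal.ofReal (c * p) := by
        rw [ENNReal.ofReal_rpow_of_nonneg (by positivity) (by positivity),
          ← Real.rpow_mul (by positivity), mul_one_div_cancel hp.ne', Real.rpow_one]

end MomentBound

section Sum

variable {M : ℕ} {n : Fin M → ℕ} {Ω : Type*} [MeasurableSpace Ω] {P : Measure Ω}

open Classical in
/-- Points of a cube-like set have at most `p` nonzero blocks: each of them adds at least `ρ` to the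
sum in the thinness condition, which is at most `2 * C₁ * δ * p ≤ ρ * p`. -/
lemma card_ne_zero_le {X : Ω → BlockVec n} {p C₁ δ ρ : ℝ} {κ : BlockVec n}
    {T : Finset (BlockVec n)} (hp : 0 ≤ p) (hρ : 0 < ρ) (hρe : ρ ≤ Real.exp (-1))
    (hρδ : ρ / Real.log (1 / ρ) = 4 * C₁ * δ) (hT : IsCubeLike P X p C₁ δ ρ κ T)
    {t : BlockVec n} (ht : t ∈ T) :
    ((Finset.univ.filter fun k => t k ≠ 0).card : ℝ) ≤ p := by
  have hlog : 1 ≤ Real.log (1 / ρ) := by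
    rw [one_div, Real.log_inv, le_neg, Real.log_le_iff_le_exp hρ]
    exact hρe
  have hδ : 2 * C₁ * δ ≤ ρ := by
    have : ρ / Real.log (1 / ρ) ≤ ρ := div_le_self hρ.le hlog
    linarith
  have hκ : ∀ k i, 0 ≤ κ k i := fun k i => hρ.le.trans (hT.le_side k i)
  have hthin := hT.thin t ht
  have hlow : ((Finset.univ.filter fun k => t k ≠ 0).card : ℝ) * ρ ≤
      ∑ k, ∑ i with t k i = κ k i, κ k i := by
    calc ((Finset.univ.filter fun k => t k ≠ 0).card : ℝ) * ρ
        = ∑ k with t k ≠ 0, ρ := by rw [Finset.sum_const, nsmul_eq_mul]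
      _ ≤ ∑ k with t k ≠ 0, ∑ i with t k i = κ k i, κ k i := by
          refine Finset.sum_le_sum fun k hk => ?_
          obtain ⟨i, hi⟩ := Function.ne_iff.1 (Finset.mem_filter.1 hk).2
          have hmem : i ∈ Finset.univ.filter fun i => t k i = κ k i :=
            Finset.mem_filter.2 ⟨Finset.mem_univ _, (hT.coord t ht k i).resolve_left hi⟩
          refine (hT.le_side k i).trans ?_
          convert! Finset.single_le_sum (f := fun i => κ k i) (fun i _ => hκ k i) hmem
      _ ≤ ∑ k, ∑ i with t k i = κ k i, κ k i :=
          Finset.sum_le_sum_of_subset_of_nonneg (Finset.filter_subset _ _)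
            fun k _ _ => Finset.sum_nonneg fun i _ => hκ k i
  have : ((Finset.univ.filter fun k => t k ≠ 0).card : ℝ) * ρ ≤ p * ρ := by
    refine hlow.trans (le_trans ?_ (by nlinarith : 2 * C₁ * δ * p ≤ p * ρ))
    convert! hthin
  exact le_of_mul_le_mul_right this hρ

open Classical in
lemma eLpNorm_truncatedExcess_le [IsProbabilityMeasure P] {pk : Fin M → ℝ} {R : Fin M → Ω → ℝ}
    {V : (k : Fin M) → Ω → Fin (n k) → ℝ} {A C D c p : ℝ} (hA : 1 ≤ A) (hc : 0 < c)
    (hC : 8 * Real.exp 1 * A * (1 + c⁻¹) ≤ C) (hn : ∀ k, 1 ≤ n k) (hpk : ∀ k, 1 < pk k)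
    (hD : 1 ≤ D) (hp : 0 < p) (hRV : IsPolarSystem pk P R V) (t : BlockVec n)
    (hcard : ((Finset.univ.filter fun k => t k ≠ 0).card : ℝ) ≤ p) :
    eLpNorm (truncatedExcess pk P R V A D C t) (ENNReal.ofReal p) P ≤
      ENNReal.ofReal (c * p) := by
  have hL : 0 ≤ c⁻¹ := by positivity
  set g : Fin M → ℝ → ℝ := fun k x => 1 + (Ioi (C * l2Norm P (R k))).indicator
    (fun _ => smallWeight A D (pk k) c⁻¹ (t k)) x with hg
  have hgm : ∀ k, Measurable (g k) := fun k =>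
    measurable_const.add (measurable_const.indicator measurableSet_Ioi)
  have hg1 : ∀ k x, 1 ≤ g k x := fun k x => by
    have : 0 ≤ (Ioi (C * l2Norm P (R k))).indicator
      (fun _ => smallWeight A D (pk k) c⁻¹ (t k)) x :=
      indicator_nonneg (fun _ _ => smallWeight_nonneg _ _ _ _ _) x
    simp only [hg]
    linarith
  have hgle : ∀ k x, g k x ≤ 1 + smallWeight A D (pk k) c⁻¹ (t k) := fun k x => by
    simp only [hg]
    gcongr
    exact indicator_le_self' (fun _ _ => smallWeight_nonneg _ _ _ _ _) x
  have hRm : ∀ k, AEMeasurable (R k) P := fun k => (hRV.law_radius k).aemeasurable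
  have hind : iIndepFun R P :=
    hRV.indep_blocks.comp (fun _ => Prod.fst) fun _ => measurable_fst
  have hl2 : ∀ k, 0 < l2Norm P (R k) := fun k => by
    have hb := bConst_pos (r := pk k) (by linarith [hpk k])
    have hnk : (0 : ℝ) < n k := by exact_mod_cast hn k
    exact lt_of_lt_of_le (by positivity) (le_l2Norm_of_hasLaw (hn k) (hpk k) (hRV.law_radius k))
  refine eLpNorm_le_of_exp_le (G := fun ω => ∏ k, g k (R k ω)) hp hc (fun ω => ?_) (fun ω => ?_)
    ?_ ?_
  · exact Finset.sum_nonneg fun k _ => le_min (by positivity) (level_nonneg (by linarith) _)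
  · rw [truncatedExcess, Finset.mul_sum, Real.exp_sum]
    exact Finset.prod_le_prod (fun _ _ => (Real.exp_pos _).le) fun k _ =>
      exp_truncated_le hD hL (hl2 k) (V k) (t k) ω
  · refine Integrable.of_bound (C := ∏ k, (1 + smallWeight A D (pk k) c⁻¹ (t k))) ?_
      (Filter.Eventually.of_forall fun ω => ?_)
    · exact (Finset.aemeasurable_fun_prod _ fun k _ =>
        (hgm k).comp_aemeasurable (hRm k)).aestronglyMeasurable
    · rw [Real.norm_of_nonneg (Finset.prod_nonneg fun k _ => zero_le_one.trans (hg1 k _))]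
      exact Finset.prod_le_prod (fun k _ => zero_le_one.trans (hg1 k _)) fun k _ => hgle k _
  · rw [hind.integral_fun_prod_comp hRm fun k => (hgm k).aestronglyMeasurable]
    calc ∏ k, ∫ ω, g k (R k ω) ∂P ≤ ∏ k, (if t k = 0 then (1 : ℝ) else 2) :=
          Finset.prod_le_prod
            (fun k _ => integral_nonneg fun ω => zero_le_one.trans (hg1 k _))
            fun k _ => integral_one_add_smallWeight_le hA hL hC (hn k) (hpk k)
              (hRV.law_radius k) (t k)
      _ = 2 ^ (Finset.univ.filter fun k => t k ≠ 0).card := by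
          rw [Finset.prod_ite, Finset.prod_const_one, one_mul, Finset.prod_const]
      _ ≤ Real.exp 1 ^ (Finset.univ.filter fun k => t k ≠ 0).card := by
          gcongr
          linarith [Real.add_one_le_exp 1]
      _ ≤ Real.exp p := by
          rw [Real.exp_one_pow]
          exact Real.exp_le_exp.2 hcard

end Sum

end RadialSudakov

theorem theorem6p3 (A c : ℝ) (hA : 1 ≤ A) (hc : 0 < c) :
    ∃ C₀ : ℝ, 0 < C₀ ∧ ∀ C : ℝ, C₀ ≤ C →
      ∀ (M : ℕ) (n : Fin M → ℕ) (pk : Fin M → ℝ) (U : Fin M → ℝ → ℝ)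
        (Ω : Type*) [MeasurableSpace Ω] (P : MeasureTheory.Measure Ω)
        [MeasureTheory.IsProbabilityMeasure P]
        (X : Ω → RadialSudakov.BlockVec n)
        (R : Fin M → Ω → ℝ) (V : (k : Fin M) → Ω → Fin (n k) → ℝ)
        (D p C₁ δ ρ : ℝ) (κ : RadialSudakov.BlockVec n)
        (T : Finset (RadialSudakov.BlockVec n)),
        (∀ k, 1 ≤ n k) → (∀ k, 1 < pk k) →
        1 ≤ D → (∀ k, D ^ (pk k).conjExponent ≤ A ^ pk k) →
        1 ≤ p → 1 ≤ C₁ → 0 < δ →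
        0 < ρ → ρ ≤ Real.exp (-1) → ρ / Real.log (1 / ρ) = 4 * C₁ * δ →
        RadialSudakov.IsRadialVector pk U P X →
        RadialSudakov.IsPolarSystem pk P R V →
        RadialSudakov.IsCubeLike P X p C₁ δ ρ κ T →
        ∀ t ∈ T,
          MeasureTheory.eLpNorm (RadialSudakov.truncatedExcess pk P R V A D C t)
            (ENNReal.ofReal p) P ≤ ENNReal.ofReal (c * p) := by
  refine ⟨8 * Real.exp 1 * A * (1 + c⁻¹), by positivity, ?_⟩
  intro C hC M n pk U Ω _ P _ X R V D p C₁ δ ρ κ T hn hpk hD _ hp _ _ hρ hρe hρδ _ hRV hT t ht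
  have hp0 : 0 < p := by linarith
  exact RadialSudakov.eLpNorm_truncatedExcess_le hA hc hC hn hpk hD hp0 hRV t
    (RadialSudakov.card_ne_zero_le hp0.le hρ hρe hρδ hT ht)
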